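/- Let $S^2$ be the unit sphere in $\mathbb{R}^3$, with unit outward normal $n(y)=y$, and let $g_0(y)=y_3^2$, $g_1(y)=y_3^2+1$ for $y=(y_1,y_2,y_3)\in S^2$. For $\varepsilon\in(0,1]$ let $$\Omega_\varepsilon=\{y+r\,n(y) \mid y\in S^2,\ \varepsilon g_0(y)<r<\varepsilon g_1(y)\}=\{ry \mid y\in S^2,\ 1+\varepsilon y_3^2<r<1+\varepsilon(y_3^2+1)\},$$ let $\Gamma_\varepsilon=\partial\Omega_\varepsilon$ with unit outward normal $n_\varepsilon$, and let $$\mathcal{R}_\varepsilon=\{w(x)=a\times x+b,\ x\in\mathbb{R}^3 \mid a,b\in\mathbb{R}^3,\ w\cdot n_\varepsilon=0 \text{ on } \Gamma_\varepsilon\}.$$ For $\beta\in[0,1)$, a constant $c_\varepsilon>0$ is called a Korn constant for $\Omega_\varepsilon$ and $\beta$ if $$\|u\|_{H^1(\Omega_\varepsilon)}\leq c_\varepsilon\|D(u)\|_{L^2(\Omega_\varepsilon)},\qquad D(u)=\frac{\nabla u+(\nabla u)^T}{2},$$ for all $u\in H^1(\Omega_\varepsilon)^3$ that satisfy $u\cdot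 n_\varepsilon=0$ on $\Gamma_\varepsilon$ (in the sense of traces) and $$\bigl|(u,w)_{L^2(\Omega_\varepsilon)}\bigr|\leq\beta\|u\|_{L^2(\Omega_\varepsilon)}\|w\|_{L^2(\Omega_\varepsilon)}\quad\text{for all } w\in\mathcal{R}_\varepsilon.$$ Then for every $\varepsilon\in(0,1]$ the domain $\Omega_\varepsilon$ is axially symmetric (invariant under the rotations by any angle) around the $x_3$-axis and around no other line. Moreover, there exist constants $c_b>0$ and $\varepsilon_b\in(0,1]$ such that, for every $\beta\in[0,1)$ and every $\varepsilon\in(0,\varepsilon_b]$, every Korn constant $c_\varepsilon$ for $\Omega_\varepsilon$ and $\beta$ satisfies $$c_\varepsilon\geq c_b\,\varepsilon^{-1}.$$ Consequently, for every $\beta\in[0,1)$ and every choice of Korn constants $c_\varepsilon$ for $\Omega_\varepsilon$ and $\beta$, $\varepsilon\in(0,1]$, we have $c_\varepsilon\to\infty$ as $\varepsilon\to0$. -/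

import Mathlib

open Set Filter Topology MeasureTheory
open scoped ContDiff Matrix

noncomputable section

/-- Three-dimensional Euclidean space. -/
abbrev E3 : Type := EuclideanSpace ℝ (Fin 3)

/-- The cross product `a × x` on Euclidean space. -/
def cross3 (a x : E3) : E3 := WithLp.toLp 2 (a.ofLp ⨯₃ x.ofLp)

/-- The `i`-th standard basis vector (`i = 0, 1, 2`). -/
def stdVec (i : Fin 3) : E3 := EuclideanSpace.single i (1 : ℝ)

/-! ### Curved thin domains -/

/-- The curved thin domain `{y + r n(y) | y ∈ Γ, ε g₀(y) < r < ε g₁(y)}` around a closed surface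
`Γ` with unit outward normal vector field `n`. -/
def thinDomain (Γ : Set E3) (n : E3 → E3) (g₀ g₁ : E3 → ℝ) (ε : ℝ) : Set E3 :=
  {x | ∃ y ∈ Γ, ∃ r : ℝ, ε * g₀ y < r ∧ r < ε * g₁ y ∧ x = y + r • n y}

/-- The curved thin domain for `Γ = S²` (whose unit outward normal at `y` is `y` itself),
`g₀(y) = y₃²` and `g₁(y) = y₃² + 1`. -/
def Omega (ε : ℝ) : Set E3 :=
  thinDomain (Metric.sphere (0 : E3) 1) (fun y => y) (fun y => y 2 ^ 2) (fun y => y 2 ^ 2 + 1) ε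

/-! ### Axial symmetry -/

/-- The rotation through the angle `θ` around the line through `p` in the direction of the unit
vector `a`. -/
def axisRotation (p a : E3) (θ : ℝ) (x : E3) : E3 :=
  p + (Real.cos θ • (x - p) + Real.sin θ • cross3 a (x - p)
    + ((1 - Real.cos θ) * inner ℝ a (x - p)) • a)

/-- `ℓ` is a line and `S` is invariant under the rotations by any angle around `ℓ`. -/
def IsAxiallySymmetricAround (S : Set E3) (ℓ : AffineSubspace ℝ E3) : Prop :=
  ∃ p a : E3, ‖a‖ = 1 ∧ ℓ = AffineSubspace.mk' p (Submodule.span ℝ {a}) ∧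
    ∀ θ : ℝ, axisRotation p a θ '' S = S

/-- The `x₃`-axis. -/
def x3Axis : AffineSubspace ℝ E3 :=
  AffineSubspace.mk' (0 : E3) (Submodule.span ℝ {stdVec 2})

/-! ### Unit outward normals and tangential rigid displacements -/

/-- `ν` is the unit outward normal of the open set `Ω` at its boundary point `x`: near `x` the set
`Ω` is `{φ < 0}` for some `C¹` function `φ` with `φ(x) = 0` whose gradient at `x` is a positive
multiple of the unit vector `ν`. -/
def IsOutwardUnitNormal (Ω : Set E3) (x ν : E3) : Prop :=
  ‖ν‖ = 1 ∧ ∃ (U : Set E3) (φ : E3 → ℝ) (k : ℝ), IsOpen U ∧ x ∈ U ∧ ContDiffOn ℝ 1 φ U ∧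
    Ω ∩ U = {y ∈ U | φ y < 0} ∧ φ x = 0 ∧ 0 < k ∧ HasGradientAt φ (k • ν) x

/-- The infinitesimal rigid displacements `w(x) = a × x + b` of `ℝ³` that are tangential on the
boundary of `Ω`. -/
def tangentialRigid (Ω : Set E3) : Set (E3 → E3) :=
  {w | (∃ a b : E3, ∀ x, w x = cross3 a x + b) ∧
    ∀ x ∈ frontier Ω, ∃ ν, IsOutwardUnitNormal Ω x ν ∧ inner ℝ (w x) ν = 0}

/-! ### `H¹` vector fields, traces, strain rate -/

/-- `u ∈ H¹(Ω)³` with weak gradient `G`, where `G x i j` is `∂ᵢ uⱼ (x)`. -/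
structure IsH1 (Ω : Set E3) (u : E3 → E3) (G : E3 → Matrix (Fin 3) (Fin 3) ℝ) : Prop where
  memLp : MemLp u 2 (volume.restrict Ω)
  memLp_grad : ∀ i j, MemLp (fun x => G x i j) 2 (volume.restrict Ω)
  weak_grad : ∀ φ : E3 → ℝ, ContDiff ℝ ∞ φ → HasCompactSupport φ → tsupport φ ⊆ Ω →
    ∀ i j, ∫ x in Ω, u x j * fderiv ℝ φ x (stdVec i) = - ∫ x in Ω, G x i j * φ x

/-- `T` is the trace on the boundary of `Ω` of the field `u ∈ H¹(Ω)³` with weak gradient `G`: there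
are fields, smooth in neighbourhoods of the closure of `Ω`, that converge to `u` in `H¹(Ω)³` and
whose boundary values converge to `T` in `L²` with respect to the surface measure. -/
def HasTrace (Ω : Set E3) (u : E3 → E3) (G : E3 → Matrix (Fin 3) (Fin 3) ℝ) (T : E3 → E3) : Prop :=
  ∃ v : ℕ → E3 → E3,
    (∀ k, ∃ V : Set E3, IsOpen V ∧ closure Ω ⊆ V ∧ ContDiffOn ℝ ∞ (v k) V) ∧
    Tendsto (fun k => eLpNorm (fun x => v k x - u x) 2 (volume.restrict Ω)) atTop (𝓝 0) ∧
    (∀ i j, Tendsto (fun k => eLpNorm (fun x => fderiv ℝ (v k) x (stdVec i) j - G x i j) 2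
      (volume.restrict Ω)) atTop (𝓝 0)) ∧
    Tendsto (fun k => eLpNorm (fun x => v k x - T x) 2
      ((μH[2] : Measure E3).restrict (frontier Ω))) atTop (𝓝 0)

/-- The impermeable boundary condition `u · n = 0` on `∂Ω`, in the sense of traces. -/
def IsImpermeable (Ω : Set E3) (u : E3 → E3) (G : E3 → Matrix (Fin 3) (Fin 3) ℝ) : Prop :=
  ∃ T : E3 → E3, HasTrace Ω u G T ∧
    ∀ᵐ x ∂((μH[2] : Measure E3).restrict (frontier Ω)),
      ∃ ν, IsOutwardUnitNormal Ω x ν ∧ inner ℝ (T x) ν = 0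

/-- The `L²(Ω)` inner product of vector fields. -/
def l2Inner (Ω : Set E3) (u w : E3 → E3) : ℝ := ∫ x in Ω, inner ℝ (u x) (w x)

/-- The `L²(Ω)` norm of a vector field. -/
def l2Norm (Ω : Set E3) (u : E3 → E3) : ℝ := Real.sqrt (∫ x in Ω, ‖u x‖ ^ 2)

/-- The `L²(Ω)` norm of a matrix field, with the Frobenius norm of matrices. -/
def l2NormMat (Ω : Set E3) (A : E3 → Matrix (Fin 3) (Fin 3) ℝ) : ℝ :=
  Real.sqrt (∫ x in Ω, ∑ i, ∑ j, A x i j ^ 2)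

/-- The `H¹(Ω)` norm of a vector field `u` with weak gradient `G`. -/
def h1Norm (Ω : Set E3) (u : E3 → E3) (G : E3 → Matrix (Fin 3) (Fin 3) ℝ) : ℝ :=
  Real.sqrt (l2Norm Ω u ^ 2 + l2NormMat Ω G ^ 2)

/-- The strain rate tensor `(∇u + (∇u)ᵀ) / 2`. -/
def strainRate (G : E3 → Matrix (Fin 3) (Fin 3) ℝ) (x : E3) : Matrix (Fin 3) (Fin 3) ℝ :=
  (1 / 2 : ℝ) • (G x + (G x)ᵀ)

/-- `c` is a constant for the standard Korn inequality `‖u‖_{H¹(Ω)} ≤ c ‖D(u)‖_{L²(Ω)}` for all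
`u ∈ H¹(Ω)³` that are impermeable on `∂Ω` and satisfy `|(u, w)| ≤ β ‖u‖ ‖w‖` in `L²(Ω)` for all
tangential infinitesimal rigid displacements `w`. -/
def IsKornConstant (Ω : Set E3) (β c : ℝ) : Prop :=
  0 < c ∧ ∀ (u : E3 → E3) (G : E3 → Matrix (Fin 3) (Fin 3) ℝ),
    IsH1 Ω u G → IsImpermeable Ω u G →
    (∀ w ∈ tangentialRigid Ω, |l2Inner Ω u w| ≤ β * l2Norm Ω u * l2Norm Ω w) →
    h1Norm Ω u G ≤ c * l2NormMat Ω (strainRate G)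

end

/-!
In terms of `level ε x = r - ε y₃²`, where `x = r y` and `r = ‖x‖`, the thin domain is the region
`1 < level ε < 1 + ε` (`mem_Omega_iff`), and the outward normals on its boundary are multiples of
the gradient of `level ε`.

A rigid displacement `a × x + b` that is tangential to the inner surface `level ε = 1` must be a
rotation field around the `x₃`-axis (`rigid_of_tangential`); it suffices to test it at five points.
This determines the tangential rigid displacements (`tangentialRigid_Omega`), and also the axes of
symmetry, because the generator of a rotation group that preserves the domain is tangential
(`tangential_of_axisRotation`).

For the Korn constant, take the rotation field around the `x₁`-axis. Its derivative of `level ε` is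
`-2 ε y₂ y₃` (while that of the radial field `y` is `1`), so adding the radial field `2 ε y₂ y₃ y`
makes it tangential to every level surface (`inner_levelGrad_testField`). The resulting field is
orthogonal to the rotation field around the `x₃`-axis by the reflection `x₃ ↦ -x₃`
(`l2Inner_testField`), hence admissible for every `β`. A rotation field has zero strain rate but a
gradient of size one, so the strain rate of the test field is `O(ε)` while its gradient stays away
from zero (`l2NormMat_strainRate_testGrad_le`, `h1Norm_testField_ge`); the ratio of the two norms
is at least a multiple of `ε⁻¹`.

In comments the coordinates are `x₁, x₂, x₃`; in the code they are `x 0`, `x 1`, `x 2`.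
-/

/-! ### Coordinates -/

lemma cross3_apply_zero (a x : E3) : cross3 a x 0 = a 1 * x 2 - a 2 * x 1 := by
  simp [cross3, cross_apply]

lemma cross3_apply_one (a x : E3) : cross3 a x 1 = a 2 * x 0 - a 0 * x 2 := by
  simp [cross3, cross_apply]

lemma cross3_apply_two (a x : E3) : cross3 a x 2 = a 0 * x 1 - a 1 * x 0 := by
  simp [cross3, cross_apply]

lemma inner_eq_sum_three (x y : E3) : inner ℝ x y = x 0 * y 0 + x 1 * y 1 + x 2 * y 2 := by
  simp [PiLp.inner_apply, Fin.sum_univ_three, mul_comm]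

lemma norm_sq_eq_sum_three (x : E3) : ‖x‖ ^ 2 = x 0 ^ 2 + x 1 ^ 2 + x 2 ^ 2 := by
  rw [← real_inner_self_eq_norm_sq, inner_eq_sum_three]; ring

lemma norm_eq_of_sq {x : E3} {r : ℝ} (hr : 0 ≤ r) (h : x 0 ^ 2 + x 1 ^ 2 + x 2 ^ 2 = r ^ 2) :
    ‖x‖ = r := by
  rw [← norm_sq_eq_sum_three] at h
  exact (sq_eq_sq₀ (norm_nonneg _) hr).1 h

lemma ext_three {x y : E3} (h0 : x 0 = y 0) (h1 : x 1 = y 1) (h2 : x 2 = y 2) : x = y := by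
  ext i; fin_cases i <;> assumption

/-! ### The outward normal -/

lemma HasGradientAt.hasDerivAt_comp {ψ : E3 → ℝ} {g x v : E3} {γ : ℝ → E3} {t : ℝ}
    (h : HasGradientAt ψ g x) (hγ : HasDerivAt γ v t) (hx : γ t = x) :
    HasDerivAt (fun s => ψ (γ s)) (inner ℝ g v) t := by
  subst hx
  exact (h.hasFDerivAt.comp_hasDerivAt t hγ).congr_deriv (by simp)

lemma HasGradientAt.neg_fun {ψ : E3 → ℝ} {g x : E3} (h : HasGradientAt ψ g x) :
    HasGradientAt (fun y => -ψ y) (-g) x := by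
  rw [hasGradientAt_iff_hasFDerivAt, map_neg]
  exact h.hasFDerivAt.neg

lemma hasDerivAt_add_smul (x v : E3) (t : ℝ) : HasDerivAt (fun s : ℝ => x + s • v) v t := by
  simpa using ((hasDerivAt_id t).smul_const v).const_add x

lemma HasGradientAt.eventually_lt {ψ : E3 → ℝ} {g x v : E3} (h : HasGradientAt ψ g x)
    (hv : inner ℝ g v < 0) : ∀ᶠ t : ℝ in 𝓝[>] 0, ψ (x + t • v) < ψ x := by
  have hd : HasDerivAt (fun s : ℝ => ψ (x + s • v) - ψ x) (inner ℝ g v) 0 :=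
    (h.hasDerivAt_comp (hasDerivAt_add_smul x v 0) (by simp)).sub_const _
  have := eventually_nhdsWithin_sign_eq_of_deriv_neg (x₀ := 0) (by rwa [hd.deriv]) (by simp)
  filter_upwards [nhdsWithin_le_nhds this, self_mem_nhdsWithin] with t ht ht0
  rw [zero_sub, sign_neg (neg_lt_zero.2 ht0), sign_eq_neg_one_iff] at ht
  linarith

lemma tendsto_add_smul_nhdsGT (x v : E3) :
    Tendsto (fun t : ℝ => x + t • v) (𝓝[>] 0) (𝓝 x) := by
  have : ContinuousAt (fun t : ℝ => x + t • v) 0 := by fun_prop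
  simpa [ContinuousAt] using this.tendsto.mono_left nhdsWithin_le_nhds

/-- If `{ψ < 0}` is contained in `Ω` near the zero `x` of `ψ`, then the gradient of `ψ` at `x` is
orthogonal to every vector that is orthogonal to an outward normal of `Ω` at `x`. -/
lemma IsOutwardUnitNormal.inner_gradient_eq_zero {Ω : Set E3} {x ν g w : E3} {ψ : E3 → ℝ}
    (hν : IsOutwardUnitNormal Ω x ν) (hψ : HasGradientAt ψ g x) (hx : ψ x = 0)
    (hΩ : ∀ᶠ y in 𝓝 x, ψ y < 0 → y ∈ Ω) (hw : inner ℝ w ν = 0) : inner ℝ g w = 0 := by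
  obtain ⟨hν1, U, φ, k, hU, hxU, -, hΩU, hφx, hk, hφ⟩ := hν
  -- A direction that strictly decreases `ψ` enters `Ω`, so it cannot strictly increase `φ`.
  have key : ∀ v, inner ℝ g v < 0 → inner ℝ v ν ≤ 0 := by
    intro v hv
    by_contra! hpos
    have h1 := hψ.eventually_lt hv
    have h2 : ∀ᶠ t : ℝ in 𝓝[>] 0, -φ (x + t • v) < -φ x := by
      refine HasGradientAt.eventually_lt (ψ := fun y => -φ y) (g := -(k • ν)) ?_ ?_
      · exact hφ.neg_fun
      · rw [inner_neg_left, real_inner_smul_left, real_inner_comm]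
        have := mul_pos hk hpos
        linarith
    obtain ⟨t, h1, h2, h3, h4⟩ := (h1.and (h2.and
      (((tendsto_add_smul_nhdsGT x v).eventually hΩ).and
        ((tendsto_add_smul_nhdsGT x v).eventually (hU.mem_nhds hxU))))).exists
    have : x + t • v ∈ Ω ∩ U := ⟨h3 (by linarith), h4⟩
    rw [hΩU] at this
    have := this.2
    linarith
  have key2 : ∀ v, inner ℝ v ν = 0 → 0 ≤ inner ℝ g v := by
    intro v hv
    by_contra! hneg
    -- Tilting `v` slightly outwards keeps the strict decrease of `ψ`.
    have hc : Tendsto (fun t : ℝ => (inner ℝ g (v + t • ν) : ℝ)) (𝓝[>] 0) (𝓝 (inner ℝ g v)) :=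
      tendsto_const_nhds.inner (tendsto_add_smul_nhdsGT v ν)
    obtain ⟨t, h1, h2⟩ := ((hc.eventually (gt_mem_nhds hneg)).and self_mem_nhdsWithin).exists
    have h3 := key _ h1
    rw [inner_add_left, hv, real_inner_smul_left, real_inner_self_eq_norm_sq, hν1] at h3
    have : 0 < t := h2
    linarith
  have h1 := key2 w hw
  have h2 := key2 (-w) (by rw [inner_neg_left, hw, neg_zero])
  rw [inner_neg_right] at h2
  linarith

/-! ### The thin domain as a region between two level sets -/

/-- The function `r - ε y₃²` of `x = r y`, `r = ‖x‖`, whose level sets `1` and `1 + ε` bound the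
thin domain. -/
noncomputable def level (ε : ℝ) (x : E3) : ℝ := ‖x‖ - ε * (x 2 / ‖x‖) ^ 2

/-- The gradient of `level ε`. -/
noncomputable def levelGrad (ε : ℝ) (x : E3) : E3 :=
  (‖x‖⁻¹ + 2 * ε * x 2 ^ 2 / ‖x‖ ^ 4) • x - (2 * ε * x 2 / ‖x‖ ^ 2) • stdVec 2

lemma inner_levelGrad (ε : ℝ) (x v : E3) : inner ℝ (levelGrad ε x) v =
    (‖x‖⁻¹ + 2 * ε * x 2 ^ 2 / ‖x‖ ^ 4) * inner ℝ x v - 2 * ε * x 2 / ‖x‖ ^ 2 * v 2 := by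
  rw [levelGrad, inner_sub_left, real_inner_smul_left, real_inner_smul_left]
  rw [stdVec, EuclideanSpace.inner_single_left]
  simp

lemma hasFDerivAt_norm_of_ne {x : E3} (hx : x ≠ 0) :
    HasFDerivAt (fun y : E3 => ‖y‖) (‖x‖⁻¹ • innerSL ℝ x) x := by
  have h := (hasStrictFDerivAt_norm_sq x).hasFDerivAt.sqrt (by simpa using hx)
  simp only [Real.sqrt_sq (norm_nonneg _)] at h
  convert! h using 1
  ext v
  have := norm_ne_zero_iff.2 hx
  simp
  field_simp

lemma hasGradientAt_level (ε : ℝ) {x : E3} (hx : x ≠ 0) :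
    HasGradientAt (level ε) (levelGrad ε x) x := by
  rw [hasGradientAt_iff_hasFDerivAt]
  have hn := hasFDerivAt_norm_of_ne hx
  have h0 := norm_ne_zero_iff.2 hx
  have h2 : HasFDerivAt (fun y : E3 => y 2) (EuclideanSpace.proj (𝕜 := ℝ) (2 : Fin 3)) x :=
    (EuclideanSpace.proj (𝕜 := ℝ) (2 : Fin 3)).hasFDerivAt
  have h := hn.sub (((h2.mul ((hasDerivAt_inv h0).comp_hasFDerivAt x hn)).pow 2).const_mul ε)
  refine (h.congr_of_eventuallyEq (Eventually.of_forall fun y => ?_)).congr_fderiv ?_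
  · simp [level, div_eq_mul_inv]
  · ext v
    simp only [InnerProductSpace.toDual_apply_apply, inner_levelGrad]
    simp
    field_simp
    ring

lemma contDiffAt_level (ε : ℝ) {x : E3} (hx : x ≠ 0) : ContDiffAt ℝ ∞ (level ε) x := by
  have hn : ContDiffAt ℝ ∞ (fun y : E3 => ‖y‖) x := contDiffAt_norm ℝ hx
  have h2 : ContDiffAt ℝ ∞ (fun y : E3 => y 2) x :=
    (EuclideanSpace.proj (𝕜 := ℝ) (2 : Fin 3)).contDiff.contDiffAt
  exact hn.sub (contDiffAt_const.mul ((h2.div hn (norm_ne_zero_iff.2 hx)).pow 2))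

lemma inner_levelGrad_self (ε : ℝ) {x : E3} (hx : x ≠ 0) :
    inner ℝ (levelGrad ε x) x = ‖x‖ := by
  have h0 := norm_ne_zero_iff.2 hx
  rw [inner_levelGrad, real_inner_self_eq_norm_sq]
  field_simp
  ring

lemma Omega_eq_polar (ε : ℝ) : Omega ε = {x | ∃ y ∈ Metric.sphere (0 : E3) 1, ∃ r : ℝ,
    1 + ε * y 2 ^ 2 < r ∧ r < 1 + ε * (y 2 ^ 2 + 1) ∧ x = r • y} := by
  ext x
  constructor
  · rintro ⟨y, hy, r, h1, h2, rfl⟩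
    exact ⟨y, hy, 1 + r, by linarith, by linarith, by rw [add_smul, one_smul]⟩
  · rintro ⟨y, hy, r, h1, h2, rfl⟩
    exact ⟨y, hy, r - 1, by linarith, by linarith, by rw [sub_smul, one_smul]; abel⟩

lemma level_smul (ε : ℝ) {y : E3} (hy : ‖y‖ = 1) {r : ℝ} (hr : 0 < r) :
    level ε (r • y) = r - ε * y 2 ^ 2 := by
  have : ‖r • y‖ = r := by rw [norm_smul, hy, Real.norm_of_nonneg hr.le, mul_one]
  rw [level, this]
  simp [hr.ne']

lemma mem_Omega_iff {ε : ℝ} (hε : 0 < ε) {x : E3} :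
    x ∈ Omega ε ↔ x ≠ 0 ∧ 1 < level ε x ∧ level ε x < 1 + ε := by
  rw [Omega_eq_polar]
  constructor
  · rintro ⟨y, hy, r, h1, h2, rfl⟩
    have hy : ‖y‖ = 1 := by simpa using hy
    have hr : 0 < r := by nlinarith [mul_nonneg hε.le (sq_nonneg (y 2))]
    rw [level_smul ε hy hr]
    refine ⟨smul_ne_zero hr.ne' (norm_ne_zero_iff.1 (by simp [hy])), by linarith, by linarith⟩
  · rintro ⟨hx, h1, h2⟩
    have h0 := norm_ne_zero_iff.2 hx
    refine ⟨‖x‖⁻¹ • x, by simp [norm_smul, h0], ‖x‖, ?_, ?_, by simp [smul_smul, h0]⟩ <;>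
    · simp only [level, div_eq_inv_mul] at h1 h2
      simp only [PiLp.smul_apply, smul_eq_mul]
      linarith

lemma isOpen_Omega {ε : ℝ} (hε : 0 < ε) : IsOpen (Omega ε) := by
  have hc : ContinuousOn (level ε) {0}ᶜ := fun x hx =>
    (contDiffAt_level ε hx).continuousAt.continuousWithinAt
  have : Omega ε = {0}ᶜ ∩ level ε ⁻¹' Ioo 1 (1 + ε) := by
    ext x; rw [mem_Omega_iff hε]; rfl
  rw [this]
  exact hc.isOpen_inter_preimage isOpen_compl_singleton isOpen_Ioo

lemma Omega_subset_annulus {ε : ℝ} (hε : 0 < ε) (h1 : ε ≤ 1) {x : E3} (hx : x ∈ Omega ε) :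
    1 < ‖x‖ ∧ ‖x‖ < 3 := by
  rw [Omega_eq_polar] at hx
  obtain ⟨y, hy, r, h2, h3, rfl⟩ := hx
  have hy : ‖y‖ = 1 := by simpa using hy
  have hy2 : y 2 ^ 2 ≤ 1 := by
    have := norm_sq_eq_sum_three y
    rw [hy] at this
    nlinarith [sq_nonneg (y 0), sq_nonneg (y 1)]
  have hr : 1 < r := by nlinarith [mul_nonneg hε.le (sq_nonneg (y 2))]
  rw [norm_smul, hy, Real.norm_of_nonneg (by linarith), mul_one]
  exact ⟨hr, by nlinarith⟩

/-- The closed spherical shell `1 ≤ ‖x‖ ≤ 3`, a compact set away from the origin that contains all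
the thin domains. -/
noncomputable def shell : Set E3 := Metric.closedBall 0 3 \ Metric.ball 0 1

lemma isCompact_shell : IsCompact shell := (isCompact_closedBall _ _).diff Metric.isOpen_ball

lemma ne_zero_of_mem_shell {x : E3} (hx : x ∈ shell) : x ≠ 0 := by
  rintro rfl
  exact hx.2 (by simp)

lemma Omega_subset_shell {ε : ℝ} (hε : 0 < ε) (h1 : ε ≤ 1) : Omega ε ⊆ shell := fun x hx => by
  have := Omega_subset_annulus hε h1 hx
  simp only [shell, Set.mem_sdiff, Metric.mem_closedBall, dist_zero_right, Metric.mem_ball]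
  exact ⟨this.2.le, by linarith [this.1]⟩

lemma closure_Omega_subset_shell {ε : ℝ} (hε : 0 < ε) (h1 : ε ≤ 1) :
    closure (Omega ε) ⊆ shell :=
  closure_minimal (Omega_subset_shell hε h1) isCompact_shell.isClosed

lemma level_mem_Icc_of_mem_closure {ε : ℝ} (hε : 0 < ε) (h1 : ε ≤ 1) {x : E3}
    (hx : x ∈ closure (Omega ε)) : level ε x ∈ Icc 1 (1 + ε) := by
  have hx0 := ne_zero_of_mem_shell (closure_Omega_subset_shell hε h1 hx)
  have hm := mem_closure_image (contDiffAt_level ε hx0).continuousAt hx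
  refine closure_minimal ?_ isClosed_Icc hm
  rintro _ ⟨y, hy, rfl⟩
  have := (mem_Omega_iff hε).1 hy
  exact ⟨this.2.1.le, this.2.2.le⟩

lemma level_eq_of_mem_frontier {ε : ℝ} (hε : 0 < ε) (h1 : ε ≤ 1) {x : E3}
    (hx : x ∈ frontier (Omega ε)) : level ε x = 1 ∨ level ε x = 1 + ε := by
  have h := level_mem_Icc_of_mem_closure hε h1 hx.1
  have hx0 := ne_zero_of_mem_shell (closure_Omega_subset_shell hε h1 hx.1)
  have hn : x ∉ Omega ε := by rw [← (isOpen_Omega hε).interior_eq]; exact hx.2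
  rw [mem_Omega_iff hε] at hn
  by_contra! hne
  exact hn ⟨hx0, lt_of_le_of_ne h.1 hne.1.symm, lt_of_le_of_ne h.2 hne.2⟩

/-- Every point of the inner level surface is a boundary point. -/
lemma mem_frontier_of_level_eq_one {ε : ℝ} (hε : 0 < ε) {x : E3} (hx : x ≠ 0)
    (hl : level ε x = 1) : x ∈ frontier (Omega ε) := by
  rw [(isOpen_Omega hε).frontier_eq]
  refine ⟨?_, fun h => by have := ((mem_Omega_iff hε).1 h).2.1; linarith⟩
  -- Moving radially outwards increases `level ε`, hence enters the domain.
  have hg := (hasGradientAt_level ε hx).neg_fun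
  have h1 := hg.eventually_lt (v := x) (by
    rw [inner_neg_left, inner_levelGrad_self ε hx]
    simpa using hx)
  have h2 : ∀ᶠ y in 𝓝 x, y ≠ 0 ∧ level ε y < 1 + ε := (eventually_ne_nhds hx).and
    ((contDiffAt_level ε hx).continuousAt.eventually (gt_mem_nhds (by linarith)))
  refine mem_closure_of_tendsto (tendsto_add_smul_nhdsGT x x) ?_
  filter_upwards [h1, (tendsto_add_smul_nhdsGT x x).eventually h2] with t h3 h4
  exact (mem_Omega_iff hε).2 ⟨h4.1, by linarith, h4.2⟩

lemma levelGrad_ne_zero (ε : ℝ) {x : E3} (hx : x ≠ 0) : levelGrad ε x ≠ 0 := by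
  intro h
  have := inner_levelGrad_self ε hx
  rw [h, inner_zero_left] at this
  exact hx (norm_eq_zero.1 this.symm)

/-- The outward normal is `∓ levelGrad ε`, normalized, on the inner and the outer surface. -/
lemma exists_normal_of_mem_frontier {ε : ℝ} (hε : 0 < ε) (h1 : ε ≤ 1) {x : E3}
    (hx : x ∈ frontier (Omega ε)) :
    ∃ ν, IsOutwardUnitNormal (Omega ε) x ν ∧ ∃ s : ℝ, ν = s • levelGrad ε x := by
  have hx0 := ne_zero_of_mem_shell (closure_Omega_subset_shell hε h1 hx.1)
  have hc : ContinuousOn (level ε) {0}ᶜ := fun y hy =>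
    (contDiffAt_level ε hy).continuousAt.continuousWithinAt
  have hcd : ∀ U : Set E3, U ⊆ {0}ᶜ → ContDiffOn ℝ 1 (level ε) U := fun U hU y hy =>
    ((contDiffAt_level ε (hU hy)).of_le (by exact_mod_cast le_top)).contDiffWithinAt
  have hg0 := norm_ne_zero_iff.2 (levelGrad_ne_zero ε hx0)
  have hgp := norm_pos_iff.2 (levelGrad_ne_zero ε hx0)
  have hgrad := (hasGradientAt_level ε hx0).hasFDerivAt
  rcases level_eq_of_mem_frontier hε h1 hx with h | h
  · refine ⟨(-‖levelGrad ε x‖⁻¹) • levelGrad ε x, ⟨by simp [norm_smul, hg0],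
      {0}ᶜ ∩ level ε ⁻¹' Iio (1 + ε), fun y => 1 - level ε y, ‖levelGrad ε x‖,
      hc.isOpen_inter_preimage isOpen_compl_singleton isOpen_Iio, ⟨hx0, by simp [h, hε]⟩,
      contDiffOn_const.sub (hcd _ inter_subset_left), ?_, by simp [h], hgp, ?_⟩, _, rfl⟩
    · ext y
      simp only [mem_inter_iff, mem_Omega_iff hε, mem_compl_iff, mem_singleton_iff, mem_preimage,
        mem_Iio, mem_ofPred_eq, sub_neg, ne_eq]
      tauto
    · rw [hasGradientAt_iff_hasFDerivAt, smul_smul, mul_neg, mul_inv_cancel₀ hg0]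
      simpa using hgrad.const_sub 1
  · refine ⟨(‖levelGrad ε x‖⁻¹) • levelGrad ε x, ⟨by simp [norm_smul, hg0],
      {0}ᶜ ∩ level ε ⁻¹' Ioi 1, fun y => level ε y - (1 + ε), ‖levelGrad ε x‖,
      hc.isOpen_inter_preimage isOpen_compl_singleton isOpen_Ioi, ⟨hx0, by simp [h, hε]⟩,
      (hcd _ inter_subset_left).sub contDiffOn_const, ?_, by simp [h], hgp, ?_⟩, _, rfl⟩
    · ext y
      simp only [mem_inter_iff, mem_Omega_iff hε, mem_compl_iff, mem_singleton_iff, mem_preimage,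
        mem_Ioi, mem_ofPred_eq, sub_neg, ne_eq]
      tauto
    · rw [hasGradientAt_iff_hasFDerivAt, smul_smul, mul_inv_cancel₀ hg0]
      simpa using hgrad.sub_const (1 + ε)

/-! ### Rigid displacements tangential to the inner surface -/

/-- A rigid displacement `a × x + b` that is tangential to the inner boundary surface is a rotation
field around the `x₃`-axis. -/
lemma rigid_of_tangential {ε : ℝ} (hε : 0 < ε) {a b : E3}
    (h : ∀ x, x ≠ 0 → level ε x = 1 → inner ℝ (levelGrad ε x) (cross3 a x + b) = 0) :
    a 0 = 0 ∧ a 1 = 0 ∧ b = 0 := by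
  -- The tangency condition at the point of the inner surface in the direction `y`.
  have key : ∀ y : E3, ‖y‖ = 1 →
      (1 + ε * y 2 ^ 2 + 2 * ε * y 2 ^ 2) * inner ℝ y b
        - 2 * ε * y 2 * ((1 + ε * y 2 ^ 2) * cross3 a y 2 + b 2) = 0 := by
    intro y hy
    set r := 1 + ε * y 2 ^ 2 with hr
    have hrp : 0 < r := by positivity
    have hn : ‖r • y‖ = r := by rw [norm_smul, hy, Real.norm_of_nonneg hrp.le, mul_one]
    have := h (r • y) (norm_ne_zero_iff.1 (by rw [hn]; exact hrp.ne'))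
      (by rw [level_smul ε hy hrp, hr]; ring)
    rw [inner_levelGrad, hn, inner_eq_sum_three] at this
    simp only [PiLp.add_apply, PiLp.smul_apply, smul_eq_mul, cross3_apply_zero, cross3_apply_one,
      cross3_apply_two] at this
    rw [inner_eq_sum_three, cross3_apply_two]
    clear_value r
    field_simp at this
    linear_combination this
  have pt : ∀ p q s : ℝ, p ^ 2 + q ^ 2 + s ^ 2 = 1 →
      (1 + ε * s ^ 2 + 2 * ε * s ^ 2) * (p * b 0 + q * b 1 + s * b 2)
        - 2 * ε * s * ((1 + ε * s ^ 2) * (a 0 * q - a 1 * p) + b 2) = 0 := by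
    intro p q s hpqs
    have := key (WithLp.toLp 2 ![p, q, s]) (norm_eq_of_sq zero_le_one (by simpa using hpqs))
    rw [inner_eq_sum_three, cross3_apply_two] at this
    simpa using this
  have hb0 : b 0 = 0 := by simpa using pt 1 0 0 (by norm_num)
  have hb1 : b 1 = 0 := by simpa using pt 0 1 0 (by norm_num)
  have hb2 : b 2 = 0 := by
    have := pt 0 0 1 (by norm_num)
    have h' : (1 + ε) * b 2 = 0 := by linear_combination this
    exact (mul_eq_zero.1 h').resolve_left (by positivity)
  -- Two rational unit vectors off the axis and off the equator isolate `a 0` and `a 1`.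
  have hp : ε * (1 + ε * (4 / 5) ^ 2) ≠ 0 := by positivity
  refine ⟨?_, ?_, ext_three hb0 hb1 hb2⟩
  · have := pt 0 (3 / 5) (4 / 5) (by norm_num)
    rw [hb0, hb1, hb2] at this
    refine (mul_eq_zero.1 (?_ : (ε * (1 + ε * (4 / 5) ^ 2)) * a 0 = 0)).resolve_left hp
    linear_combination (-25 / 24) * this
  · have := pt (3 / 5) 0 (4 / 5) (by norm_num)
    rw [hb0, hb1, hb2] at this
    refine (mul_eq_zero.1 (?_ : (ε * (1 + ε * (4 / 5) ^ 2)) * a 1 = 0)).resolve_left hp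
    linear_combination (25 / 24) * this

lemma tangentialRigid_Omega {ε : ℝ} (hε : 0 < ε) {w : E3 → E3}
    (hw : w ∈ tangentialRigid (Omega ε)) : ∃ a : E3, a 0 = 0 ∧ a 1 = 0 ∧ ∀ x, w x = cross3 a x := by
  obtain ⟨⟨a, b, hab⟩, ht⟩ := hw
  have := rigid_of_tangential hε (a := a) (b := b) fun x hx hl => by
    obtain ⟨ν, hν, hin⟩ := ht x (mem_frontier_of_level_eq_one hε hx hl)
    have hg : HasGradientAt (fun y => 1 - level ε y) (-levelGrad ε x) x := by
      rw [hasGradientAt_iff_hasFDerivAt]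
      simpa using (hasGradientAt_level ε hx).hasFDerivAt.const_sub 1
    have hΩ : ∀ᶠ y in 𝓝 x, 1 - level ε y < 0 → y ∈ Omega ε := by
      filter_upwards [eventually_ne_nhds hx, (contDiffAt_level ε hx).continuousAt.eventually
        (gt_mem_nhds (show level ε x < 1 + ε by linarith))] with y h1 h2 h3
      exact (mem_Omega_iff hε).2 ⟨h1, by linarith, h2⟩
    have := hν.inner_gradient_eq_zero hg (by simp [hl]) hΩ hin
    rwa [inner_neg_left, neg_eq_zero, hab] at this
  exact ⟨a, this.1, this.2.1, fun x => by rw [hab, this.2.2, add_zero]⟩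

/-! ### Axial symmetry -/

/-- The cross product `a × ·` as a continuous linear map. -/
noncomputable def cross3CLM (a : E3) : E3 →L[ℝ] E3 :=
  (IsLinearMap.mk' (cross3 a)
    ⟨fun x y => by simp [cross3], fun c x => by simp [cross3]⟩).toContinuousLinearMap

lemma cross3CLM_apply (a x : E3) : cross3CLM a x = cross3 a x := rfl

lemma cross3_sub (a x p : E3) : cross3 a (x - p) = cross3 a x + -cross3 a p := by
  rw [← cross3CLM_apply, map_sub, sub_eq_add_neg]; rfl

lemma contDiff_cross3 (a : E3) : ContDiff ℝ ∞ (cross3 a) := (cross3CLM a).contDiff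

lemma continuous_axisRotation (p a : E3) (θ : ℝ) : Continuous (axisRotation p a θ) := by
  have := (contDiff_cross3 a).continuous
  unfold axisRotation
  fun_prop

lemma axisRotation_zero (p a x : E3) : axisRotation p a 0 x = x := by
  simp [axisRotation]

lemma hasDerivAt_axisRotation (p a x : E3) :
    HasDerivAt (fun θ => axisRotation p a θ x) (cross3 a x + -cross3 a p) 0 := by
  have h1 := (Real.hasDerivAt_cos 0).smul_const (x - p)
  have h2 := (Real.hasDerivAt_sin 0).smul_const (cross3 a (x - p))
  have h3 := (((Real.hasDerivAt_cos 0).const_sub 1).mul_const (inner ℝ a (x - p))).smul_const a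
  have := ((h1.add h2).add h3).const_add p
  refine this.congr_deriv ?_
  rw [← cross3_sub]
  simp

lemma mem_Omega_congr {ε : ℝ} (hε : 0 < ε) {x y : E3} (hn : ‖x‖ = ‖y‖) (h2 : x 2 ^ 2 = y 2 ^ 2) :
    x ∈ Omega ε ↔ y ∈ Omega ε := by
  rw [mem_Omega_iff hε, mem_Omega_iff hε, ← norm_ne_zero_iff, ← norm_ne_zero_iff (a := y), level,
    level, div_pow, div_pow, hn, h2]

lemma axisRotation_x3_apply (θ : ℝ) (x : E3) :
    axisRotation 0 (stdVec 2) θ x 0 = Real.cos θ * x 0 - Real.sin θ * x 1 ∧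
    axisRotation 0 (stdVec 2) θ x 1 = Real.cos θ * x 1 + Real.sin θ * x 0 ∧
    axisRotation 0 (stdVec 2) θ x 2 = x 2 := by
  refine ⟨?_, ?_, ?_⟩ <;>
  · simp [axisRotation, inner_eq_sum_three, cross3_apply_zero, cross3_apply_one, cross3_apply_two,
      stdVec]
    try ring

lemma axisRotation_x3_mem {ε : ℝ} (hε : 0 < ε) (θ : ℝ) {x : E3} (hx : x ∈ Omega ε) :
    axisRotation 0 (stdVec 2) θ x ∈ Omega ε := by
  obtain ⟨h0, h1, h2⟩ := axisRotation_x3_apply θ x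
  refine (mem_Omega_congr hε (norm_eq_of_sq (norm_nonneg _) ?_) (by rw [h2])).2 hx
  rw [h0, h1, h2, norm_sq_eq_sum_three]
  linear_combination (x 0 ^ 2 + x 1 ^ 2) * Real.sin_sq_add_cos_sq θ

lemma axisRotation_x3_neg (θ : ℝ) (x : E3) :
    axisRotation 0 (stdVec 2) θ (axisRotation 0 (stdVec 2) (-θ) x) = x := by
  obtain ⟨h0, h1, h2⟩ := axisRotation_x3_apply θ (axisRotation 0 (stdVec 2) (-θ) x)
  obtain ⟨k0, k1, k2⟩ := axisRotation_x3_apply (-θ) x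
  rw [k0, k1, Real.cos_neg, Real.sin_neg] at h0 h1
  rw [k2] at h2
  refine ext_three ?_ ?_ h2
  · rw [h0]; linear_combination x 0 * Real.sin_sq_add_cos_sq θ
  · rw [h1]; linear_combination x 1 * Real.sin_sq_add_cos_sq θ

lemma isAxiallySymmetricAround_x3Axis {ε : ℝ} (hε : 0 < ε) :
    IsAxiallySymmetricAround (Omega ε) x3Axis := by
  refine ⟨0, stdVec 2, by simp [stdVec], rfl, fun θ => Subset.antisymm ?_ fun x hx => ?_⟩
  · rintro _ ⟨x, hx, rfl⟩
    exact axisRotation_x3_mem hε θ hx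
  · exact ⟨_, axisRotation_x3_mem hε (-θ) hx, axisRotation_x3_neg θ x⟩

/-- The generator of a one-parameter group of rotations that preserves the thin domain is
tangential to the inner surface: along an orbit, `level ε` is minimal at points of that surface. -/
lemma tangential_of_axisRotation {ε : ℝ} (hε : 0 < ε) (h1 : ε ≤ 1) {p a : E3}
    (h : ∀ θ, axisRotation p a θ '' Omega ε = Omega ε) {x : E3} (hx : x ≠ 0)
    (hl : level ε x = 1) : inner ℝ (levelGrad ε x) (cross3 a x + -cross3 a p) = 0 := by
  have hcl : x ∈ closure (Omega ε) := (mem_frontier_of_level_eq_one hε hx hl).1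
  have hmem : ∀ θ, axisRotation p a θ x ∈ closure (Omega ε) := fun θ => by
    have := image_closure_subset_closure_image (continuous_axisRotation p a θ)
      (mem_image_of_mem _ hcl)
    rwa [h θ] at this
  have hd := (hasGradientAt_level ε hx).hasDerivAt_comp (hasDerivAt_axisRotation p a x)
    (axisRotation_zero p a x)
  refine IsLocalMin.hasDerivAt_eq_zero (Eventually.of_forall fun θ => ?_) hd
  rw [axisRotation_zero, hl]
  exact (level_mem_Icc_of_mem_closure hε h1 (hmem θ)).1

lemma eq_x3Axis_of_isAxiallySymmetricAround {ε : ℝ} (hε : 0 < ε) (h1 : ε ≤ 1)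
    {ℓ : AffineSubspace ℝ E3} (h : IsAxiallySymmetricAround (Omega ε) ℓ) : ℓ = x3Axis := by
  obtain ⟨p, a, ha, rfl, hrot⟩ := h
  obtain ⟨ha0, ha1, hb⟩ := rigid_of_tangential hε (a := a) (b := -cross3 a p)
    fun x hx hl => tangential_of_axisRotation hε h1 hrot hx hl
  have ha2 : a 2 ≠ 0 := by
    intro ha2
    have : a = 0 := ext_three ha0 ha1 ha2
    simp [this] at ha
  have hae : a = a 2 • stdVec 2 := ext_three (by simp [stdVec, ha0]) (by simp [stdVec, ha1])
    (by simp [stdVec])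
  have hspan : Submodule.span ℝ {a} = Submodule.span ℝ {stdVec 2} := by
    rw [hae]
    exact Submodule.span_singleton_smul_eq (IsUnit.mk0 _ ha2) _
  rw [neg_eq_zero] at hb
  have hp1 : p 1 = 0 := by
    have := cross3_apply_zero a p
    rw [hb, ha1] at this
    simpa [ha2] using this
  have hp0 : p 0 = 0 := by
    have := cross3_apply_one a p
    rw [hb, ha0] at this
    simpa [ha2] using this
  have hp : p ∈ x3Axis := by
    rw [x3Axis, AffineSubspace.mem_mk', vsub_eq_sub, sub_zero, Submodule.mem_span_singleton]
    exact ⟨p 2, ext_three (by simp [stdVec, hp0]) (by simp [stdVec, hp1]) (by simp [stdVec])⟩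
  rw [hspan, ← AffineSubspace.mk'_eq hp, x3Axis, AffineSubspace.direction_mk']

/-! ### The test field -/

/-- The radial field `2 y₂ y₃ y`, `y = x / ‖x‖`. -/
noncomputable def radialCorrection (x : E3) : E3 := (2 * (x 1 * x 2) / ‖x‖ ^ 3) • x

/-- The rotation field around the `x₁`-axis, corrected by an `O(ε)` radial field that makes it
tangential to all level surfaces of `level ε`. -/
noncomputable def testField (ε : ℝ) (x : E3) : E3 := cross3 (stdVec 0) x + ε • radialCorrection x

/-- The gradient of the test field, with the index of the derivative first. -/
noncomputable def testGrad (ε : ℝ) (x : E3) : Matrix (Fin 3) (Fin 3) ℝ :=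
  fun i j => fderiv ℝ (testField ε) x (stdVec i) j

lemma contDiffAt_radialCorrection {x : E3} (hx : x ≠ 0) :
    ContDiffAt ℝ ∞ radialCorrection x := by
  have hn : ContDiffAt ℝ ∞ (fun y : E3 => ‖y‖) x := contDiffAt_norm ℝ hx
  have hc : ∀ i : Fin 3, ContDiffAt ℝ ∞ (fun y : E3 => y i) x := fun i =>
    (EuclideanSpace.proj (𝕜 := ℝ) i).contDiff.contDiffAt
  exact ((contDiffAt_const.mul ((hc 1).mul (hc 2))).div (hn.pow 3)
    (pow_ne_zero 3 (norm_ne_zero_iff.2 hx))).smul contDiffAt_id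

lemma contDiffAt_testField (ε : ℝ) {x : E3} (hx : x ≠ 0) : ContDiffAt ℝ ∞ (testField ε) x :=
  (contDiff_cross3 _).contDiffAt.add ((contDiffAt_radialCorrection hx).const_smul ε)

lemma continuousOn_fderiv_of_contDiffAt {f : E3 → E3} (hf : ∀ x ≠ 0, ContDiffAt ℝ ∞ f x) :
    ContinuousOn (fderiv ℝ f) {0}ᶜ :=
  ContDiffOn.continuousOn_fderiv_of_isOpen (n := ∞)
    (fun x hx => (hf x hx).contDiffWithinAt) isOpen_compl_singleton (by exact_mod_cast le_top)

lemma inner_levelGrad_testField (ε : ℝ) {x : E3} (hx : x ≠ 0) :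
    inner ℝ (levelGrad ε x) (testField ε x) = 0 := by
  have h0 := norm_ne_zero_iff.2 hx
  rw [testField, inner_add_right, real_inner_smul_right, radialCorrection, real_inner_smul_right,
    inner_levelGrad_self ε hx, inner_levelGrad, inner_eq_sum_three, cross3_apply_zero,
    cross3_apply_one, cross3_apply_two]
  simp [stdVec]
  field_simp
  ring

lemma testGrad_apply (ε : ℝ) {x : E3} (hx : x ≠ 0) (i j : Fin 3) :
    testGrad ε x i j = cross3 (stdVec 0) (stdVec i) j
      + ε * fderiv ℝ radialCorrection x (stdVec i) j := by
  have h1 : HasFDerivAt (cross3 (stdVec 0)) (cross3CLM (stdVec 0)) x :=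
    (cross3CLM (stdVec 0)).hasFDerivAt
  have h2 := ((contDiffAt_radialCorrection hx).differentiableAt (by simp)).hasFDerivAt
  have h3 : HasFDerivAt (testField ε) _ x := h1.add (h2.const_smul ε)
  rw [testGrad, h3.fderiv]
  simp [cross3CLM_apply]

/-- The symmetric part of the gradient of the test field comes from the correction alone. -/
lemma strainRate_testGrad (ε : ℝ) {x : E3} (hx : x ≠ 0) (i j : Fin 3) :
    strainRate (testGrad ε) x i j = ε * ((fderiv ℝ radialCorrection x (stdVec i) j
      + fderiv ℝ radialCorrection x (stdVec j) i) / 2) := by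
  have : cross3 (stdVec 0) (stdVec i) j + cross3 (stdVec 0) (stdVec j) i = 0 := by
    fin_cases i <;> fin_cases j <;>
    simp [cross3_apply_zero, cross3_apply_one, cross3_apply_two, stdVec]
  simp only [strainRate, Matrix.smul_apply, Matrix.add_apply, Matrix.transpose_apply,
    testGrad_apply ε hx, smul_eq_mul]
  linear_combination (1 / 2) * this

lemma exists_bound_fderiv_radialCorrection : ∃ C : ℝ, 1 ≤ C ∧ ∀ x ∈ shell, ∀ i j,
    |fderiv ℝ radialCorrection x (stdVec i) j| ≤ C := by
  have hc : ContinuousOn (fderiv ℝ radialCorrection) shell :=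
    (continuousOn_fderiv_of_contDiffAt fun x hx => contDiffAt_radialCorrection hx).mono
      fun x hx => ne_zero_of_mem_shell hx
  obtain ⟨C, hC⟩ := isCompact_shell.exists_bound_of_continuousOn hc
  refine ⟨max 1 C, le_max_left _ _, fun x hx i j => ?_⟩
  calc |fderiv ℝ radialCorrection x (stdVec i) j|
      ≤ ‖fderiv ℝ radialCorrection x (stdVec i)‖ :=
        PiLp.norm_apply_le (fderiv ℝ radialCorrection x (stdVec i)) j
    _ ≤ ‖fderiv ℝ radialCorrection x‖ * ‖stdVec i‖ := ContinuousLinearMap.le_opNorm _ _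
    _ ≤ max 1 C := by
      rw [show ‖stdVec i‖ = 1 by simp [stdVec], mul_one]
      exact (hC x hx).trans (le_max_right _ _)

/-! ### Admissibility of the test field -/

lemma isFiniteMeasure_restrict_Omega {ε : ℝ} (hε : 0 < ε) (h1 : ε ≤ 1) :
    IsFiniteMeasure (volume.restrict (Omega ε)) :=
  ⟨by
    rw [Measure.restrict_apply_univ]
    exact (measure_mono (Omega_subset_shell hε h1)).trans_lt isCompact_shell.measure_lt_top⟩

lemma memLp_of_continuousOn {F : Type*} [NormedAddCommGroup F] {f : E3 → F}
    (hf : ContinuousOn f {0}ᶜ) {ε : ℝ} (hε : 0 < ε) (h1 : ε ≤ 1) :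
    MemLp f 2 (volume.restrict (Omega ε)) := by
  have := isFiniteMeasure_restrict_Omega hε h1
  have hsh : ContinuousOn f shell := hf.mono fun x hx => ne_zero_of_mem_shell hx
  obtain ⟨C, hC⟩ := isCompact_shell.exists_bound_of_continuousOn hsh
  have hm := (isOpen_Omega hε).measurableSet
  refine MemLp.of_bound ((hsh.mono (Omega_subset_shell hε h1)).aestronglyMeasurable hm) C ?_
  filter_upwards [ae_restrict_mem hm] with x hx using hC x (Omega_subset_shell hε h1 hx)

lemma continuousOn_testField (ε : ℝ) : ContinuousOn (testField ε) {0}ᶜ := fun _ hx =>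
  (contDiffAt_testField ε hx).continuousAt.continuousWithinAt

lemma continuousOn_testGrad (ε : ℝ) (i j : Fin 3) :
    ContinuousOn (fun x => testGrad ε x i j) {0}ᶜ := by
  have h := continuousOn_fderiv_of_contDiffAt fun x hx => contDiffAt_testField ε (x := x) hx
  exact (EuclideanSpace.proj (𝕜 := ℝ) j).continuous.comp_continuousOn
    (h.clm_apply continuousOn_const)

lemma integrable_mul_of_tsupport {f g : E3 → ℝ} {s : Set E3} (hf : ContinuousOn f s)
    (hg : Continuous g) (hgc : HasCompactSupport g) (hs : tsupport g ⊆ s) :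
    Integrable (fun x => f x * g x) := by
  have h : IntegrableOn (fun x => f x * g x) (tsupport g) :=
    ((hf.mono hs).mul hg.continuousOn).integrableOn_compact hgc
  refine (integrableOn_iff_integrable_of_support_subset ?_).1 h
  exact (Function.support_mul_subset_right f g).trans (subset_tsupport g)

lemma testGrad_weak {ε : ℝ} (hε : 0 < ε) (h1 : ε ≤ 1) {φ : E3 → ℝ} (hφ : ContDiff ℝ ∞ φ)
    (hc : HasCompactSupport φ) (hs : tsupport φ ⊆ Omega ε) (i j : Fin 3) :
    ∫ x in Omega ε, testField ε x j * fderiv ℝ φ x (stdVec i)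
      = - ∫ x in Omega ε, testGrad ε x i j * φ x := by
  have hne : ∀ x ∈ tsupport φ, x ≠ 0 := fun x hx =>
    ne_zero_of_mem_shell (Omega_subset_shell hε h1 (hs hx))
  have hs0 : tsupport φ ⊆ {0}ᶜ := hne
  have hz : ∀ x, x ∉ Omega ε → φ x = 0 := fun x hx => image_eq_zero_of_notMem_tsupport
    fun h => hx (hs h)
  have hfd : ∀ x, x ≠ 0 → HasFDerivAt (fun y => testField ε y j)
      ((EuclideanSpace.proj (𝕜 := ℝ) j).comp (fderiv ℝ (testField ε) x)) x := fun x hx =>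
    (EuclideanSpace.proj (𝕜 := ℝ) j).hasFDerivAt.comp x
      ((contDiffAt_testField ε hx).differentiableAt (by simp)).hasFDerivAt
  have hG : ∀ x, testGrad ε x i j * φ x
      = fderiv ℝ (fun y => testField ε y j) x (stdVec i) * φ x := fun x => by
    by_cases hx : x ∈ tsupport φ
    · rw [(hfd x (hne x hx)).fderiv]; rfl
    · rw [image_eq_zero_of_notMem_tsupport hx, mul_zero, mul_zero]
  have hts : tsupport (fun x => fderiv ℝ φ x (stdVec i)) ⊆ tsupport φ :=
    tsupport_fderiv_apply_subset ℝ (stdVec i)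
  rw [setIntegral_eq_integral_of_forall_compl_eq_zero,
    setIntegral_eq_integral_of_forall_compl_eq_zero]
  · simp_rw [hG]
    refine integral_mul_fderiv_eq_neg_fderiv_mul_of_integrable ?_ ?_ ?_
      (fun x hx => (hfd x (hne x hx)).differentiableAt)
      (fun x _ => hφ.contDiffAt.differentiableAt (by simp))
    · simp_rw [← hG]
      exact integrable_mul_of_tsupport (continuousOn_testGrad ε i j) hφ.continuous hc hs0
    · exact integrable_mul_of_tsupport
        ((EuclideanSpace.proj (𝕜 := ℝ) j).continuous.comp_continuousOn (continuousOn_testField ε))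
        ((hφ.continuous_fderiv (by simp)).clm_apply continuous_const)
        (hc.fderiv_apply ℝ (stdVec i)) (hts.trans hs0)
    · exact integrable_mul_of_tsupport
        ((EuclideanSpace.proj (𝕜 := ℝ) j).continuous.comp_continuousOn (continuousOn_testField ε))
        hφ.continuous hc hs0
  · intro x hx; rw [hz x hx, mul_zero]
  · intro x hx
    have h0 : fderiv ℝ φ x (stdVec i) = 0 :=
      image_eq_zero_of_notMem_tsupport (f := fun x => fderiv ℝ φ x (stdVec i))
        fun h => hx (hs (hts h))
    rw [h0, mul_zero]

lemma isH1_testField {ε : ℝ} (hε : 0 < ε) (h1 : ε ≤ 1) :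
    IsH1 (Omega ε) (testField ε) (testGrad ε) where
  memLp := memLp_of_continuousOn (continuousOn_testField ε) hε h1
  memLp_grad i j := memLp_of_continuousOn (continuousOn_testGrad ε i j) hε h1
  weak_grad _ hφ hc hs i j := testGrad_weak hε h1 hφ hc hs i j

/-- The test field is smooth near the closure of the domain, so it is its own trace. -/
lemma isImpermeable_testField {ε : ℝ} (hε : 0 < ε) (h1 : ε ≤ 1) :
    IsImpermeable (Omega ε) (testField ε) (testGrad ε) := by
  refine ⟨testField ε, ⟨fun _ => testField ε, fun _ => ⟨{0}ᶜ, isOpen_compl_singleton,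
    fun x hx => ne_zero_of_mem_shell (closure_Omega_subset_shell hε h1 hx),
    fun x hx => (contDiffAt_testField ε hx).contDiffWithinAt⟩, by simp, fun i j => by
      simp [testGrad], by simp⟩, ?_⟩
  filter_upwards [ae_restrict_mem isClosed_frontier.measurableSet] with x hx
  obtain ⟨ν, hν, s, rfl⟩ := exists_normal_of_mem_frontier hε h1 hx
  refine ⟨_, hν, ?_⟩
  rw [real_inner_smul_right, real_inner_comm, inner_levelGrad_testField ε
    (ne_zero_of_mem_shell (closure_Omega_subset_shell hε h1 hx.1)), mul_zero]

/-- The reflection `x₃ ↦ -x₃`. -/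
noncomputable def reflectX3 : E3 ≃ₗᵢ[ℝ] E3 :=
  LinearIsometryEquiv.piLpCongrRight 2 fun i : Fin 3 =>
    if i = 2 then LinearIsometryEquiv.neg ℝ else LinearIsometryEquiv.refl ℝ ℝ

lemma reflectX3_apply (x : E3) :
    reflectX3 x 0 = x 0 ∧ reflectX3 x 1 = x 1 ∧ reflectX3 x 2 = -x 2 := by
  simp [reflectX3]

/-- The thin domain is symmetric under `x₃ ↦ -x₃` and `x₁ x₃` is odd. -/
lemma integral_mul_eq_zero {ε : ℝ} (hε : 0 < ε) : ∫ x in Omega ε, x 0 * x 2 = 0 := by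
  have hpre : reflectX3 ⁻¹' Omega ε = Omega ε := by
    ext x
    obtain ⟨-, -, h2⟩ := reflectX3_apply x
    exact mem_Omega_congr hε (reflectX3.norm_map x) (by rw [h2, neg_sq])
  have h := reflectX3.measurePreserving.setIntegral_preimage_emb
    reflectX3.toHomeomorph.measurableEmbedding (fun x : E3 => x 0 * x 2) (Omega ε)
  rw [hpre] at h
  have h' : ∀ x : E3, reflectX3 x 0 * reflectX3 x 2 = -(x 0 * x 2) := fun x => by
    obtain ⟨h0, -, h2⟩ := reflectX3_apply x
    rw [h0, h2, mul_neg]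
  simp_rw [h', integral_neg] at h
  linarith

/-- The test field is orthogonal in `L²` to the rotations around the `x₃`-axis. -/
lemma l2Inner_testField {ε : ℝ} (hε : 0 < ε) {w : E3 → E3}
    (hw : w ∈ tangentialRigid (Omega ε)) : l2Inner (Omega ε) (testField ε) w = 0 := by
  obtain ⟨a, ha0, ha1, hw⟩ := tangentialRigid_Omega hε hw
  have : ∀ x, inner ℝ (testField ε x) (w x) = -a 2 * (x 0 * x 2) := fun x => by
    rw [hw, testField, inner_eq_sum_three, radialCorrection]
    simp only [PiLp.add_apply, PiLp.smul_apply, smul_eq_mul, cross3_apply_zero, cross3_apply_one,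
      cross3_apply_two, ha0, ha1]
    simp [stdVec]
    ring
  simp_rw [l2Inner, this, integral_const_mul, integral_mul_eq_zero hε, mul_zero]

/-! ### The lower bound for the Korn constant -/

lemma volume_real_Omega_pos {ε : ℝ} (hε : 0 < ε) (h1 : ε ≤ 1) :
    0 < volume.real (Omega ε) := by
  have hfin : volume (Omega ε) ≠ ⊤ :=
    ((measure_mono (Omega_subset_shell hε h1)).trans_lt isCompact_shell.measure_lt_top).ne
  refine ENNReal.toReal_pos (((isOpen_Omega hε).measure_pos volume ?_).ne') hfin
  have hmem : stdVec 0 ∈ frontier (Omega ε) := by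
    refine mem_frontier_of_level_eq_one hε (norm_ne_zero_iff.1 (by simp [stdVec])) ?_
    simp [level, stdVec]
  exact closure_nonempty_iff.1 ⟨_, hmem.1⟩

/-- One entry of the gradient of the rotation field is `1`, so the `H¹` norm of the test field is
bounded below by a multiple of the square root of the volume. -/
lemma h1Norm_testField_ge {C : ℝ}
    (hC : ∀ x ∈ shell, ∀ i j, |fderiv ℝ radialCorrection x (stdVec i) j| ≤ C) {ε : ℝ}
    (hε : 0 < ε) (h1 : ε ≤ 1) (hεC : ε * C ≤ 1 / 2) :
    Real.sqrt (volume.real (Omega ε)) / 2 ≤ h1Norm (Omega ε) (testField ε) (testGrad ε) := by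
  have hm := (isOpen_Omega hε).measurableSet
  have hfin := isFiniteMeasure_restrict_Omega hε h1
  have hint : IntegrableOn (fun x => ∑ i, ∑ j, testGrad ε x i j ^ 2) (Omega ε) :=
    integrable_finsetSum _ fun i _ => integrable_finsetSum _ fun j _ =>
      (memLp_of_continuousOn (continuousOn_testGrad ε i j) hε h1).integrable_sq
  have hpt : ∀ x ∈ Omega ε, (1 / 4 : ℝ) ≤ ∑ i, ∑ j, testGrad ε x i j ^ 2 := fun x hx => by
    have hsh := Omega_subset_shell hε h1 hx
    have h12 : testGrad ε x 1 2 = 1 + ε * fderiv ℝ radialCorrection x (stdVec 1) 2 := by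
      rw [testGrad_apply ε (ne_zero_of_mem_shell hsh), cross3_apply_two]
      simp [stdVec]
    have hb := neg_le_of_abs_le (hC x hsh 1 2)
    have hge : 1 / 2 ≤ testGrad ε x 1 2 := by
      rw [h12]
      nlinarith [mul_le_mul_of_nonneg_left hb hε.le]
    calc (1 / 4 : ℝ) ≤ testGrad ε x 1 2 ^ 2 := by nlinarith
      _ ≤ ∑ j, testGrad ε x 1 j ^ 2 := Finset.single_le_sum
          (f := fun j => testGrad ε x 1 j ^ 2) (fun j _ => sq_nonneg _) (Finset.mem_univ 2)
      _ ≤ ∑ i, ∑ j, testGrad ε x i j ^ 2 := Finset.single_le_sum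
          (f := fun i => ∑ j, testGrad ε x i j ^ 2)
          (fun i _ => Finset.sum_nonneg fun j _ => sq_nonneg _) (Finset.mem_univ 1)
  have hI := setIntegral_mono_on (integrable_const (1 / 4 : ℝ)) hint hm hpt
  rw [setIntegral_const, smul_eq_mul] at hI
  have hV : 0 ≤ volume.real (Omega ε) := measureReal_nonneg
  rw [h1Norm]
  refine Real.le_sqrt_of_sq_le ?_
  rw [div_pow, Real.sq_sqrt hV, l2NormMat, Real.sq_sqrt (by linarith)]
  nlinarith [sq_nonneg (l2Norm (Omega ε) (testField ε))]

lemma l2NormMat_strainRate_testGrad_le {C : ℝ} (hC0 : 0 ≤ C)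
    (hC : ∀ x ∈ shell, ∀ i j, |fderiv ℝ radialCorrection x (stdVec i) j| ≤ C) {ε : ℝ}
    (hε : 0 < ε) (h1 : ε ≤ 1) :
    l2NormMat (Omega ε) (strainRate (testGrad ε))
      ≤ 3 * C * ε * Real.sqrt (volume.real (Omega ε)) := by
  have hfin : volume (Omega ε) < ⊤ :=
    (measure_mono (Omega_subset_shell hε h1)).trans_lt isCompact_shell.measure_lt_top
  have hpt : ∀ x ∈ Omega ε, ‖∑ i, ∑ j, strainRate (testGrad ε) x i j ^ 2‖ ≤ (3 * C * ε) ^ 2 := by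
    intro x hx
    have hsh := Omega_subset_shell hε h1 hx
    refine (Real.norm_of_nonneg (Finset.sum_nonneg fun i _ => Finset.sum_nonneg fun j _ =>
      sq_nonneg _)).trans_le ?_
    have hij : ∀ i j, strainRate (testGrad ε) x i j ^ 2 ≤ (ε * C) ^ 2 := fun i j => by
      rw [strainRate_testGrad ε (ne_zero_of_mem_shell hsh), sq_le_sq, abs_mul, abs_mul,
        abs_of_nonneg hC0]
      have h2 := abs_le.1 (hC x hsh i j)
      have h3 := abs_le.1 (hC x hsh j i)
      exact mul_le_mul_of_nonneg_left (abs_le.2 ⟨by linarith, by linarith⟩) (abs_nonneg _)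
    calc ∑ i, ∑ j, strainRate (testGrad ε) x i j ^ 2
        ≤ ∑ _i : Fin 3, ∑ _j : Fin 3, (ε * C) ^ 2 :=
          Finset.sum_le_sum fun i _ => Finset.sum_le_sum fun j _ => hij i j
      _ = (3 * C * ε) ^ 2 := by simp; ring
  have hI := (le_abs_self _).trans (norm_setIntegral_le_of_norm_le_const hfin hpt)
  calc l2NormMat (Omega ε) (strainRate (testGrad ε))
      ≤ Real.sqrt ((3 * C * ε) ^ 2 * volume.real (Omega ε)) := Real.sqrt_le_sqrt hI
    _ = 3 * C * ε * Real.sqrt (volume.real (Omega ε)) := by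
      rw [Real.sqrt_mul (sq_nonneg _), Real.sqrt_sq (by positivity)]

lemma exists_korn_lower_bound : ∃ c_b : ℝ, 0 < c_b ∧ ∃ ε_b : ℝ, 0 < ε_b ∧ ε_b ≤ 1 ∧
    ∀ β : ℝ, 0 ≤ β → β < 1 → ∀ ε : ℝ, 0 < ε → ε ≤ ε_b →
      ∀ c : ℝ, IsKornConstant (Omega ε) β c → c_b * ε⁻¹ ≤ c := by
  obtain ⟨C, hC1, hC⟩ := exists_bound_fderiv_radialCorrection
  have hC0 : 0 < C := by linarith
  have hle : 1 / (2 * C) ≤ 1 := by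
    rw [div_le_one (by positivity)]; linarith
  refine ⟨1 / (6 * C), by positivity, 1 / (2 * C), by positivity, hle, ?_⟩
  rintro β hβ - ε hε hεb c ⟨hc, hK⟩
  have h1 : ε ≤ 1 := hεb.trans hle
  have hεC : ε * C ≤ 1 / 2 := by
    rw [le_div_iff₀ (by positivity)] at hεb; linarith
  have hkorn := hK _ _ (isH1_testField hε h1) (isImpermeable_testField hε h1) fun w hw => by
    rw [l2Inner_testField hε hw, abs_zero]
    exact mul_nonneg (mul_nonneg hβ (Real.sqrt_nonneg _)) (Real.sqrt_nonneg _)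
  have hV := Real.sqrt_pos.2 (volume_real_Omega_pos hε h1)
  have hlow := h1Norm_testField_ge hC hε h1 hεC
  have hup := mul_le_mul_of_nonneg_left (l2NormMat_strainRate_testGrad_le hC0.le hC hε h1) hc.le
  set S := Real.sqrt (volume.real (Omega ε))
  have hfin : 1 / 2 ≤ c * (3 * C * ε) := by
    refine le_of_mul_le_mul_right ?_ hV
    calc 1 / 2 * S = S / 2 := by ring
      _ ≤ c * (3 * C * ε * S) := hlow.trans (hkorn.trans hup)
      _ = c * (3 * C * ε) * S := by ring
  rw [← div_eq_mul_inv, div_div, div_le_iff₀ (by positivity)]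
  linarith

theorem lemma4p14 :
    (∀ ε : ℝ, 0 < ε → ε ≤ 1 →
      Omega ε = {x | ∃ y ∈ Metric.sphere (0 : E3) 1, ∃ r : ℝ,
        1 + ε * y 2 ^ 2 < r ∧ r < 1 + ε * (y 2 ^ 2 + 1) ∧ x = r • y} ∧
      ∀ ℓ : AffineSubspace ℝ E3, IsAxiallySymmetricAround (Omega ε) ℓ ↔ ℓ = x3Axis) ∧
    (∃ c_b : ℝ, 0 < c_b ∧ ∃ ε_b : ℝ, 0 < ε_b ∧ ε_b ≤ 1 ∧
      ∀ β : ℝ, 0 ≤ β → β < 1 → ∀ ε : ℝ, 0 < ε → ε ≤ ε_b →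
        ∀ c : ℝ, IsKornConstant (Omega ε) β c → c_b * ε⁻¹ ≤ c) ∧
    (∀ β : ℝ, 0 ≤ β → β < 1 → ∀ c : ℝ → ℝ,
      (∀ ε : ℝ, 0 < ε → ε ≤ 1 → IsKornConstant (Omega ε) β (c ε)) →
        Tendsto c (𝓝[>] 0) atTop) := by
  refine ⟨fun ε hε h1 => ⟨Omega_eq_polar ε, fun ℓ =>
    ⟨eq_x3Axis_of_isAxiallySymmetricAround hε h1, ?_⟩⟩, exists_korn_lower_bound, ?_⟩
  · rintro rfl
    exact isAxiallySymmetricAround_x3Axis hε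
  · intro β hβ hβ1 c hc
    obtain ⟨c_b, hcb, ε_b, hεb, hεb1, h⟩ := exists_korn_lower_bound
    refine tendsto_atTop_mono' _ ?_ (tendsto_inv_nhdsGT_zero.const_mul_atTop hcb)
    filter_upwards [Ioc_mem_nhdsGT hεb] with ε hε
    exact h β hβ hβ1 ε hε.1 hε.2 _ (hc ε hε.1 (hε.2.trans hεb1))
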